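/- **Conventions.** Manifolds are smooth, finite-dimensional, Hausdorff and second countable. A semi-Riemannian metric is a smooth symmetric nondegenerate $(0,2)$-tensor field (its signature is arbitrary). For a 1-form, $d\eta(X,Y)=\tfrac12\big(X(\eta(Y))-Y(\eta(X))-\eta([X,Y])\big)$. An *indefinite $S$-manifold* is a manifold $\tilde M$ with a nowhere zero $(1,1)$-tensor field $\varphi$, vector fields $\xi_1,\dots,\xi_s$ and 1-forms $\eta^1,\dots,\eta^s$ ($s\ge 1$), a semi-Riemannian metric $\tilde g$ and signs $\epsilon_\alpha=\pm1$ such that $\varphi^2=-I+\sum_\alpha\eta^\alpha\otimes\xi_\alpha$, $\varphi\xi_\alpha=0$, $\eta^\alpha(\xi_\beta)=\delta^\alpha_\beta$, $\tilde g(\varphi X,\varphi Y)=\tilde g(X,Y)-\sum_\alpha\epsilon_\alpha\eta^\alpha(X)\eta^\alpha(Y)$, which is normal, $[\varphi,\varphi]+2\sum_\alpha d\eta^\alpha\otimes\xi_\alpha=0$ (where $[\varphi,\varphi]$ is the Nijenhuis torsion), and satisfies $d\eta^\alpha(X,Y)=\tilde g(X,\varphi Y)$ for every $\alpha$. Let $(N^\perp,g_1)$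 and $(N^T,g_2)$ be semi-Riemannian manifolds with $N^\perp$ connected and $N^T$ non-empty, and let $f$ be a positive smooth function on $N^\perp$. A smooth map $\iota:N^\perp\times N^T\to\tilde M$ is a *warped product CR-submanifold* $M=N^\perp\times_f N^T$ if * $\iota^*\tilde g=g_1+f^2g_2$ (so that $\iota$ is an immersion); * each slice $N^\perp\times\{q\}$ is totally real ($\varphi$ maps its tangent spaces into their orthogonal complements), and each slice $\{p\}\times N^T$ is $\varphi$-invariant ($\varphi$ maps its tangent spaces into themselves); * for each $\alpha$, either $\xi_\alpha$ is tangent to $N^T$ (that is, to all slices $\{p\}\times N^T$), or $\xi_\alpha$ is tangent to $N^\perp$ (that is, to all slices $N^\perp\times\{q\}$). It is a *CR-product* of $(N^\perp,g_1)$ and $(N^T,g_2)$ if $\iota^*\tilde g=g_1+g_2$ and the slices $N^\perp\times\{q\}$ are totally real and the slices $\{p\}\times N^T$ are $\varphi$-invariant; it is a *contact CR-product* if moreover every $\xi_\alpha$ is tangent to $N^T$. **Theorem 3.2.** Let $M=N^\perp\times_f N^T$ be a warped product CR-submanifold of an indefinite $S$-manifold $\tilde M$, with $\dim N^T\ge1$.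 Then $f$ is a constant $c>0$, and $M$ is a CR-product of $(N^\perp,g_1)$ and $(N^T,c^2g_2)$. If, moreover, all $\xi_\alpha$ are tangent to $N^T$ or all $\xi_\alpha$ are tangent to $N^\perp$, then $M$ is a contact CR-product of $(N^\perp,g_1)$ and $(N^T,c^2g_2)$. In particular there is no warped product CR-submanifold $N^\perp\times_f N^T$ with non-constant $f$. -/

import Mathlib

open scoped Manifold ContDiff Bundle

noncomputable section

/-- A smooth semi-Riemannian metric on a manifold `M` modelled on `E`: a smooth symmetric
nondegenerate covariant 2-tensor field. -/
structure SemiRiemannianMetric (E M : Type*) [NormedAddCommGroup E] [NormedSpace ℝ E]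
    [TopologicalSpace M] [ChartedSpace E M] [IsManifold 𝓘(ℝ, E) ∞ M] where
  /-- The scalar product on each tangent space. -/
  val (x : M) : TangentSpace 𝓘(ℝ, E) x →L[ℝ] TangentSpace 𝓘(ℝ, E) x →L[ℝ] ℝ
  symm (x : M) (v w : TangentSpace 𝓘(ℝ, E) x) : val x v w = val x w v
  nondegenerate (x : M) (v : TangentSpace 𝓘(ℝ, E) x) (hv : ∀ w, val x v w = 0) : v = 0
  contMDiff : ContMDiff 𝓘(ℝ, E) (𝓘(ℝ, E).prod 𝓘(ℝ, E →L[ℝ] E →L[ℝ] ℝ)) ∞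
    (fun x ↦ Bundle.TotalSpace.mk' (E →L[ℝ] E →L[ℝ] ℝ)
      (E := fun x : M ↦ TangentSpace 𝓘(ℝ, E) x →L[ℝ] TangentSpace 𝓘(ℝ, E) x →L[ℝ] ℝ) x (val x))

set_option synthInstance.maxHeartbeats 400000 in
/-- The metric `c • g`, for a nonzero constant `c`. -/
def SemiRiemannianMetric.scale {E M : Type*} [NormedAddCommGroup E] [NormedSpace ℝ E]
    [TopologicalSpace M] [ChartedSpace E M] [IsManifold 𝓘(ℝ, E) ∞ M]
    (g : SemiRiemannianMetric E M) (c : ℝ) (hc : c ≠ 0) : SemiRiemannianMetric E M where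
  val x := c • g.val x
  symm x v w := by
    change c * g.val x v w = c * g.val x w v
    rw [g.symm]
  nondegenerate x v hv := by
    refine g.nondegenerate x v fun w ↦ ?_
    have h : c * g.val x v w = 0 := hv w
    exact (mul_eq_zero.1 h).resolve_left hc
  contMDiff := g.contMDiff.const_smul_section (a := c)

/-- Smoothness at a point `x` of a vector field on a manifold modelled on `E`. -/
def SmoothFieldAt {E M : Type*} [NormedAddCommGroup E] [NormedSpace ℝ E]
    [TopologicalSpace M] [ChartedSpace E M] [IsManifold 𝓘(ℝ, E) ∞ M]
    (X : ∀ x : M, TangentSpace 𝓘(ℝ, E) x) (x : M) : Prop :=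
  ContMDiffAt 𝓘(ℝ, E) 𝓘(ℝ, E).tangent ∞ (fun y ↦ (⟨y, X y⟩ : TangentBundle 𝓘(ℝ, E) M)) x

/-- The derivative `v(u)` of a real function `u` at `x` in the direction of the tangent vector
`v`. -/
def dirDeriv {E M : Type*} [NormedAddCommGroup E] [NormedSpace ℝ E]
    [TopologicalSpace M] [ChartedSpace E M]
    (u : M → ℝ) (x : M) (v : TangentSpace 𝓘(ℝ, E) x) : ℝ :=
  mfderiv 𝓘(ℝ, E) 𝓘(ℝ, ℝ) u x v

/-- The exterior derivative of a 1-form `η` evaluated on two vector fields, with the convention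
`dη(X, Y) = (1/2) (X(η(Y)) - Y(η(X)) - η([X, Y]))`. -/
def extDerivOneForm {E M : Type*} [NormedAddCommGroup E] [NormedSpace ℝ E]
    [TopologicalSpace M] [ChartedSpace E M]
    (η : ∀ x : M, TangentSpace 𝓘(ℝ, E) x →L[ℝ] ℝ)
    (X Y : ∀ x : M, TangentSpace 𝓘(ℝ, E) x) (x : M) : ℝ :=
  (1 / 2 : ℝ) *
    (dirDeriv (fun y ↦ η y (Y y)) x (X x) - dirDeriv (fun y ↦ η y (X y)) x (Y x)
      - η x (VectorField.mlieBracket 𝓘(ℝ, E) X Y x))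

/-- The Nijenhuis torsion of a (1,1)-tensor field `φ` evaluated on two vector fields:
`[φ, φ](X, Y) = φ²[X, Y] + [φX, φY] - φ[φX, Y] - φ[X, φY]`. -/
def nijenhuis {E M : Type*} [NormedAddCommGroup E] [NormedSpace ℝ E]
    [TopologicalSpace M] [ChartedSpace E M]
    (φ : ∀ x : M, TangentSpace 𝓘(ℝ, E) x →L[ℝ] TangentSpace 𝓘(ℝ, E) x)
    (X Y : ∀ x : M, TangentSpace 𝓘(ℝ, E) x) (x : M) : TangentSpace 𝓘(ℝ, E) x :=
  φ x (φ x (VectorField.mlieBracket 𝓘(ℝ, E) X Y x))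
    + VectorField.mlieBracket 𝓘(ℝ, E) (fun y ↦ φ y (X y)) (fun y ↦ φ y (Y y)) x
    - φ x (VectorField.mlieBracket 𝓘(ℝ, E) (fun y ↦ φ y (X y)) Y x)
    - φ x (VectorField.mlieBracket 𝓘(ℝ, E) X (fun y ↦ φ y (Y y)) x)

/-- A globally framed `f`-structure on a manifold: a nowhere zero (1,1)-tensor field `φ`, global
vector fields `ξ_α` spanning `ker φ` and 1-forms `η^α` with `φ² = -I + ∑ η^α ⊗ ξ_α` and
`η^α(ξ_β) = δ^α_β`. (These identities force `ker φ` to be the span of the linearly independent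
`ξ_α`, so `φ` has constant rank.) -/
structure GloballyFramedFStructure (E M : Type*) [NormedAddCommGroup E] [NormedSpace ℝ E]
    [TopologicalSpace M] [ChartedSpace E M] [IsManifold 𝓘(ℝ, E) ∞ M] (s : ℕ) where
  /-- The (1,1)-tensor field. -/
  φ (x : M) : TangentSpace 𝓘(ℝ, E) x →L[ℝ] TangentSpace 𝓘(ℝ, E) x
  /-- The characteristic vector fields. -/
  ξ (α : Fin s) (x : M) : TangentSpace 𝓘(ℝ, E) x
  /-- The dual 1-forms. -/
  η (α : Fin s) (x : M) : TangentSpace 𝓘(ℝ, E) x →L[ℝ] ℝ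
  φ_smooth : ContMDiff 𝓘(ℝ, E) (𝓘(ℝ, E).prod 𝓘(ℝ, E →L[ℝ] E)) ∞
    (fun x ↦ Bundle.TotalSpace.mk' (E →L[ℝ] E)
      (E := fun x : M ↦ TangentSpace 𝓘(ℝ, E) x →L[ℝ] TangentSpace 𝓘(ℝ, E) x) x (φ x))
  ξ_smooth (α : Fin s) (x : M) : SmoothFieldAt (ξ α) x
  η_smooth (α : Fin s) : ContMDiff 𝓘(ℝ, E) (𝓘(ℝ, E).prod 𝓘(ℝ, E →L[ℝ] ℝ)) ∞
    (fun x ↦ Bundle.TotalSpace.mk' (E →L[ℝ] ℝ)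
      (E := fun x : M ↦ TangentSpace 𝓘(ℝ, E) x →L[ℝ] ℝ) x (η α x))
  φ_ne_zero (x : M) : φ x ≠ 0
  φ_ξ (α : Fin s) (x : M) : φ x (ξ α x) = 0
  φ_sq (x : M) (v : TangentSpace 𝓘(ℝ, E) x) : φ x (φ x v) = -v + ∑ α, η α x v • ξ α x
  η_ξ (α β : Fin s) (x : M) : η α x (ξ β x) = if α = β then 1 else 0

/-- An indefinite globally framed `f`-structure: a globally framed `f`-structure with a
semi-Riemannian metric `g` and signs `ε_α = ±1` such that
`g(φX, φY) = g(X, Y) - ∑ ε_α η^α(X) η^α(Y)`.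
(It follows that `η^α(X) = ε_α g(X, ξ_α)` and `g(ξ_α, ξ_α) = ε_α`.) -/
structure IndefiniteGFFStructure (E M : Type*) [NormedAddCommGroup E] [NormedSpace ℝ E]
    [TopologicalSpace M] [ChartedSpace E M] [IsManifold 𝓘(ℝ, E) ∞ M] (s : ℕ)
    extends GloballyFramedFStructure E M s where
  /-- The semi-Riemannian metric. -/
  g : SemiRiemannianMetric E M
  /-- The causal characters of the `ξ_α`. -/
  ε (α : Fin s) : ℝ
  ε_eq (α : Fin s) : ε α = 1 ∨ ε α = -1
  compatible (x : M) (v w : TangentSpace 𝓘(ℝ, E) x) :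
    g.val x (φ x v) (φ x w) = g.val x v w - ∑ α, ε α * η α x v * η α x w

/-- An indefinite `S`-structure: an indefinite globally framed `f`-structure which is normal,
`[φ, φ] + 2 ∑ dη^α ⊗ ξ_α = 0`, and satisfies `dη^α = Φ` for every `α`, where
`Φ(X, Y) = g(X, φY)`. -/
structure IndefiniteSStructure (E M : Type*) [NormedAddCommGroup E] [NormedSpace ℝ E]
    [TopologicalSpace M] [ChartedSpace E M] [IsManifold 𝓘(ℝ, E) ∞ M] (s : ℕ)
    extends IndefiniteGFFStructure E M s where
  normal (X Y : ∀ x : M, TangentSpace 𝓘(ℝ, E) x) (x : M)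
    (hX : SmoothFieldAt X x) (hY : SmoothFieldAt Y x) :
    nijenhuis φ X Y x + ∑ α, (2 * extDerivOneForm (η α) X Y x) • ξ α x = 0
  dη_eq (α : Fin s) (X Y : ∀ x : M, TangentSpace 𝓘(ℝ, E) x) (x : M)
    (hX : SmoothFieldAt X x) (hY : SmoothFieldAt Y x) :
    extDerivOneForm (η α) X Y x = g.val x (X x) (φ x (Y x))

section Submanifolds

variable {E M : Type*} [NormedAddCommGroup E] [NormedSpace ℝ E]
  [TopologicalSpace M] [ChartedSpace E M] [IsManifold 𝓘(ℝ, E) ∞ M] {s : ℕ}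
  {F N : Type*} [NormedAddCommGroup F] [NormedSpace ℝ F]
  [TopologicalSpace N] [ChartedSpace F N]

/-- The submanifold `j : N → M` is tangent to the vector field `X` of the ambient manifold. -/
def IsTangentTo (j : N → M) (X : ∀ x : M, TangentSpace 𝓘(ℝ, E) x) : Prop :=
  ∀ y : N, ∃ v : TangentSpace 𝓘(ℝ, F) y, mfderiv 𝓘(ℝ, F) 𝓘(ℝ, E) j y v = X (j y)

/-- The submanifold `j : N → M` is `φ`-invariant: `φ(T_y N) ⊆ T_y N`. -/
def IsInvariantSubmanifold (S : IndefiniteSStructure E M s) (j : N → M) : Prop :=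
  ∀ (y : N) (v : TangentSpace 𝓘(ℝ, F) y), ∃ w : TangentSpace 𝓘(ℝ, F) y,
    mfderiv 𝓘(ℝ, F) 𝓘(ℝ, E) j y w = S.φ (j y) (mfderiv 𝓘(ℝ, F) 𝓘(ℝ, E) j y v)

/-- The submanifold `j : N → M` is totally real (`φ`-anti-invariant): `φ(T_y N)` is orthogonal
to `T_y N`. -/
def IsTotallyRealSubmanifold (S : IndefiniteSStructure E M s) (j : N → M) : Prop :=
  ∀ (y : N) (v w : TangentSpace 𝓘(ℝ, F) y),
    S.g.val (j y) (S.φ (j y) (mfderiv 𝓘(ℝ, F) 𝓘(ℝ, E) j y v))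
      (mfderiv 𝓘(ℝ, F) 𝓘(ℝ, E) j y w) = 0

end Submanifolds

section WarpedProducts

variable {E M : Type*} [NormedAddCommGroup E] [NormedSpace ℝ E]
  [TopologicalSpace M] [ChartedSpace E M] [IsManifold 𝓘(ℝ, E) ∞ M] {s : ℕ}
  {E₁ N₁ : Type*} [NormedAddCommGroup E₁] [NormedSpace ℝ E₁]
  [TopologicalSpace N₁] [ChartedSpace E₁ N₁] [IsManifold 𝓘(ℝ, E₁) ∞ N₁]
  {E₂ N₂ : Type*} [NormedAddCommGroup E₂] [NormedSpace ℝ E₂]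
  [TopologicalSpace N₂] [ChartedSpace E₂ N₂] [IsManifold 𝓘(ℝ, E₂) ∞ N₂]

/-- `ι` realizes the warped product `N₁ ×_f N₂` as a semi-Riemannian submanifold of `(M, g)`:
`f` is a positive smooth function on `N₁` and the smooth map `ι : N₁ × N₂ → M` pulls `g` back to
the warped product metric `g₁ + f² g₂`. (This metric being nondegenerate, `ι` is automatically
an immersion.) -/
structure IsWarpedProductSubmanifold (g : SemiRiemannianMetric E M)
    (g₁ : SemiRiemannianMetric E₁ N₁) (g₂ : SemiRiemannianMetric E₂ N₂) (f : N₁ → ℝ)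
    (ι : N₁ × N₂ → M) : Prop where
  f_smooth : ContMDiff 𝓘(ℝ, E₁) 𝓘(ℝ, ℝ) ∞ f
  f_pos (p : N₁) : 0 < f p
  ι_smooth : ContMDiff (𝓘(ℝ, E₁).prod 𝓘(ℝ, E₂)) 𝓘(ℝ, E) ∞ ι
  isometric (p : N₁) (q : N₂) (v₁ w₁ : TangentSpace 𝓘(ℝ, E₁) p)
    (v₂ w₂ : TangentSpace 𝓘(ℝ, E₂) q) :
    g.val (ι (p, q)) (mfderiv (𝓘(ℝ, E₁).prod 𝓘(ℝ, E₂)) 𝓘(ℝ, E) ι (p, q) (v₁, v₂))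
        (mfderiv (𝓘(ℝ, E₁).prod 𝓘(ℝ, E₂)) 𝓘(ℝ, E) ι (p, q) (w₁, w₂))
      = g₁.val p v₁ w₁ + f p ^ 2 * g₂.val q v₂ w₂

/-- `ι` realizes `N₁ × N₂` with the metric `g₁ + f² g₂` as a warped product CR-submanifold
`N₁ ×_f N₂`, with `N₁ = N^⊥` totally real and `N₂ = N^T` `φ`-invariant, of a manifold with an
indefinite `S`-structure; each `ξ_α` is tangent to `N^T` or tangent to `N^⊥`. -/
structure IsWarpedProductCRSubmanifold (S : IndefiniteSStructure E M s)
    (g₁ : SemiRiemannianMetric E₁ N₁) (g₂ : SemiRiemannianMetric E₂ N₂) (f : N₁ → ℝ)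
    (ι : N₁ × N₂ → M) : Prop extends IsWarpedProductSubmanifold S.g g₁ g₂ f ι where
  totallyReal (q : N₂) : IsTotallyRealSubmanifold (F := E₁) S (fun p ↦ ι (p, q))
  invariant (p : N₁) : IsInvariantSubmanifold (F := E₂) S (fun q ↦ ι (p, q))
  ξ_tangent (α : Fin s) :
    (∀ p : N₁, IsTangentTo (F := E₂) (fun q ↦ ι (p, q)) (S.ξ α)) ∨
    (∀ q : N₂, IsTangentTo (F := E₁) (fun p ↦ ι (p, q)) (S.ξ α))

/-- `ι` realizes `N₁ × N₂` as a CR-product: the smooth map `ι` pulls the ambient metric back to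
the Riemannian product metric `g₁ + g₂`, the factor `N₁` is totally real and the factor `N₂` is
`φ`-invariant. -/
structure IsCRProduct (S : IndefiniteSStructure E M s)
    (g₁ : SemiRiemannianMetric E₁ N₁) (g₂ : SemiRiemannianMetric E₂ N₂)
    (ι : N₁ × N₂ → M) : Prop where
  ι_smooth : ContMDiff (𝓘(ℝ, E₁).prod 𝓘(ℝ, E₂)) 𝓘(ℝ, E) ∞ ι
  isometric (p : N₁) (q : N₂) (v₁ w₁ : TangentSpace 𝓘(ℝ, E₁) p)
    (v₂ w₂ : TangentSpace 𝓘(ℝ, E₂) q) :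
    S.g.val (ι (p, q)) (mfderiv (𝓘(ℝ, E₁).prod 𝓘(ℝ, E₂)) 𝓘(ℝ, E) ι (p, q) (v₁, v₂))
        (mfderiv (𝓘(ℝ, E₁).prod 𝓘(ℝ, E₂)) 𝓘(ℝ, E) ι (p, q) (w₁, w₂))
      = g₁.val p v₁ w₁ + g₂.val q v₂ w₂
  totallyReal (q : N₂) : IsTotallyRealSubmanifold (F := E₁) S (fun p ↦ ι (p, q))
  invariant (p : N₁) : IsInvariantSubmanifold (F := E₂) S (fun q ↦ ι (p, q))

/-- A contact CR-product: a CR-product whose `φ`-invariant factor `N₂` is tangent to every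
`ξ_α`. -/
structure IsContactCRProduct (S : IndefiniteSStructure E M s)
    (g₁ : SemiRiemannianMetric E₁ N₁) (g₂ : SemiRiemannianMetric E₂ N₂)
    (ι : N₁ × N₂ → M) : Prop extends IsCRProduct S g₁ g₂ ι where
  ξ_tangent (α : Fin s) (p : N₁) : IsTangentTo (F := E₂) (fun q ↦ ι (p, q)) (S.ξ α)

end WarpedProducts

end

/-! The identity `dη^α = Φ`, with `Φ(X, Y) = g(X, φY)`, is pulled back to the product and read on
constant coordinate fields, whose brackets vanish: `u(η(v)) - v(η(u)) = 2 g(u, φ v)`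
(`fderiv_pullbackForm_sub`). Moreover `η^α` is, up to the sign `ε_α`, the metric dual of `ξ_α`, so
it kills each factor orthogonal to `ξ_α`.

Suppose `ξ_α` is tangent to `N₁`. Then `η^α` vanishes along `N₂`, hence so does `Φ`. If this held
for every `α`, then for `y` tangent to `N₂` the vector `φ y` would be tangent to `N₂` and orthogonal
to it, so zero, and `φ² y = -y` would give `y = 0`, against `dim N₂ ≥ 1`. So some `ξ_α` is tangent
to `N₂`.

For that `α`, take `v` tangent to `N₁` and `x` tangent to `N₂`. Since `η^α(v) = 0` and `φ x` stays
tangent to `N₂`, the identity reduces to `v(η^α(x)) = 0`. Thus `η^α(x) = ε_α f² g₂(x, u)` does not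
depend on the point of `N₁`, where `u` is the vector of `N₂` representing `ξ_α`. So `f² u` is
constant along `N₁`, while `f² g₂(u, u) = ε_α`; together these make `f` constant. -/

open Filter Topology

/-! ### Coordinate frames and exterior derivatives of 1-forms -/

section ChartFields

variable {E M : Type*} [NormedAddCommGroup E] [NormedSpace ℝ E]
  [TopologicalSpace M] [ChartedSpace E M] [IsManifold 𝓘(ℝ, E) ∞ M]

/-- The coordinate vector field with constant components `a` in the preferred chart at `x₀`. -/
noncomputable def chartField (x₀ : M) (a : E) (y : M) : TangentSpace 𝓘(ℝ, E) y :=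
  (trivializationAt E (TangentSpace 𝓘(ℝ, E)) x₀).symmL ℝ y a

/-- The components of a 1-form in the preferred chart at `x₀`. -/
noncomputable def coordForm (η : ∀ x : M, TangentSpace 𝓘(ℝ, E) x →L[ℝ] ℝ) (x₀ y : M) : E →L[ℝ] ℝ :=
  (η y).comp ((trivializationAt E (TangentSpace 𝓘(ℝ, E)) x₀).symmL ℝ y)

theorem coordForm_apply (η : ∀ x : M, TangentSpace 𝓘(ℝ, E) x →L[ℝ] ℝ) (x₀ y : M) (a : E) :
    coordForm η x₀ y a = η y (chartField x₀ a y) := rfl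

theorem smoothFieldAt_chartField (x₀ : M) (a : E) : SmoothFieldAt (chartField x₀ a) x₀ := by
  have h := (trivializationAt E (TangentSpace 𝓘(ℝ, E)) x₀).contMDiffAt_symmL (n := ∞)
    (IB := 𝓘(ℝ, E)) (x := x₀) (FiberBundle.mem_baseSet_trivializationAt' x₀)
  have hc : ContMDiffAt 𝓘(ℝ, E) (𝓘(ℝ, E).prod 𝓘(ℝ, E)) ∞
      (fun y : M ↦ Bundle.TotalSpace.mk' E (E := Bundle.Trivial M E) y a) x₀ := by
    rw [Bundle.contMDiffAt_totalSpace]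
    exact ⟨contMDiffAt_id, contMDiffAt_const⟩
  exact ContMDiffAt.clm_bundle_apply (F₁ := E) (E₁ := Bundle.Trivial M E) h hc

theorem contMDiffAt_coordForm {η : ∀ x : M, TangentSpace 𝓘(ℝ, E) x →L[ℝ] ℝ}
    (hη : ContMDiff 𝓘(ℝ, E) (𝓘(ℝ, E).prod 𝓘(ℝ, E →L[ℝ] ℝ)) ∞
      (fun x ↦ Bundle.TotalSpace.mk' (E →L[ℝ] ℝ)
        (E := fun x : M ↦ TangentSpace 𝓘(ℝ, E) x →L[ℝ] ℝ) x (η x))) (x₀ : M) :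
    ContMDiffAt 𝓘(ℝ, E) 𝓘(ℝ, E →L[ℝ] ℝ) ∞ (coordForm η x₀) x₀ := by
  have h := ((contMDiffAt_hom_bundle _).1 (hη x₀)).2
  refine h.congr_of_eventuallyEq (Eventually.of_forall fun y ↦ ?_)
  ext a
  simp [coordForm, ContinuousLinearMap.inCoordinates]

theorem chartField_mfderiv_extChartAt {x₀ y : M} (hy : y ∈ (chartAt E x₀).source)
    (v : TangentSpace 𝓘(ℝ, E) y) :
    chartField x₀ (show E from mfderiv 𝓘(ℝ, E) 𝓘(ℝ, E) (extChartAt 𝓘(ℝ, E) x₀) y v) y = v := by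
  have : IsManifold 𝓘(ℝ, E) 1 M := IsManifold.of_le (n := ∞) (by simp)
  rw [← TangentBundle.continuousLinearMapAt_trivializationAt hy]
  exact Bundle.Trivialization.symmL_continuousLinearMapAt _ (by simpa using hy) v

/-- In the chart at `x₀` both fields become constant near the base point, and constant fields
commute. -/
theorem mlieBracket_chartField (x₀ : M) (a b : E) :
    VectorField.mlieBracket 𝓘(ℝ, E) (chartField x₀ a) (chartField x₀ b) x₀ = 0 := by
  have : IsManifold 𝓘(ℝ, E) 1 M := IsManifold.of_le (n := ∞) (by simp)
  -- On the chart domain the trivialization's inverse is the derivative of the inverse chart, which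
  -- the pullback inverts.
  have key (c : E) : VectorField.mpullbackWithin 𝓘(ℝ, E) 𝓘(ℝ, E) (extChartAt 𝓘(ℝ, E) x₀).symm
      (chartField x₀ c) (Set.range 𝓘(ℝ, E)) =ᶠ[𝓝 (extChartAt 𝓘(ℝ, E) x₀ x₀)] fun _ ↦ c := by
    filter_upwards [extChartAt_target_mem_nhds (I := 𝓘(ℝ, E)) x₀] with z hz
    have hs : (extChartAt 𝓘(ℝ, E) x₀).symm z ∈ (chartAt E x₀).source := by
      simpa using (extChartAt 𝓘(ℝ, E) x₀).map_target hz
    have h := TangentBundle.symmL_trivializationAt (I := 𝓘(ℝ, E)) (𝕜 := ℝ) hs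
    rw [(extChartAt 𝓘(ℝ, E) x₀).right_inv hz] at h
    rw [VectorField.mpullbackWithin_apply, chartField, h]
    have hi := isInvertible_mfderivWithin_extChartAt_symm (I := 𝓘(ℝ, E)) hz
    exact hi.inverse_apply_eq.2 rfl
  have hz (U V : E → E) (hU : U =ᶠ[𝓝 (extChartAt 𝓘(ℝ, E) x₀ x₀)] fun _ ↦ a)
      (hV : V =ᶠ[𝓝 (extChartAt 𝓘(ℝ, E) x₀ x₀)] fun _ ↦ b) :
      VectorField.lieBracketWithin ℝ U V
        ((extChartAt 𝓘(ℝ, E) x₀).symm ⁻¹' Set.univ ∩ Set.range 𝓘(ℝ, E))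
        (extChartAt 𝓘(ℝ, E) x₀ x₀) = 0 := by
    rw [show ((extChartAt 𝓘(ℝ, E) x₀).symm ⁻¹' Set.univ ∩ Set.range 𝓘(ℝ, E)) = Set.univ by simp,
      VectorField.lieBracketWithin_univ, hU.lieBracket_vectorField_eq hV]
    simp [VectorField.lieBracket]
  rw [VectorField.mlieBracket, VectorField.mlieBracketWithin_apply]
  exact (congrArg _ (hz _ _ (key a) (key b))).trans (map_zero _)

/-- The bracket term drops out, and the factor 2 cancels the `1/2` of the convention for `dη`. What
remains is the antisymmetrized derivative of the components. -/
theorem two_mul_extDerivOneForm_chartField (η : ∀ x : M, TangentSpace 𝓘(ℝ, E) x →L[ℝ] ℝ)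
    (x₀ : M) (h : MDifferentiableAt 𝓘(ℝ, E) 𝓘(ℝ, E →L[ℝ] ℝ) (coordForm η x₀) x₀) (a b : E) :
    2 * extDerivOneForm η (chartField x₀ a) (chartField x₀ b) x₀ =
      (show E →L[ℝ] ℝ from mfderiv 𝓘(ℝ, E) 𝓘(ℝ, E →L[ℝ] ℝ) (coordForm η x₀) x₀
        (chartField x₀ a x₀)) b -
      (show E →L[ℝ] ℝ from mfderiv 𝓘(ℝ, E) 𝓘(ℝ, E →L[ℝ] ℝ) (coordForm η x₀) x₀
        (chartField x₀ b x₀)) a := by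
  have key (c : E) (v : TangentSpace 𝓘(ℝ, E) x₀) :
      dirDeriv (fun y ↦ η y (chartField x₀ c y)) x₀ v =
        (show E →L[ℝ] ℝ from mfderiv 𝓘(ℝ, E) 𝓘(ℝ, E →L[ℝ] ℝ) (coordForm η x₀) x₀ v) c := by
    have h1 : HasMFDerivAt 𝓘(ℝ, E →L[ℝ] ℝ) 𝓘(ℝ, ℝ) (fun A : E →L[ℝ] ℝ ↦ A c) (coordForm η x₀ x₀)
        (ContinuousLinearMap.apply ℝ ℝ c) :=
      (ContinuousLinearMap.apply ℝ ℝ c).hasFDerivAt.hasMFDerivAt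
    have h2 := (h1.comp x₀ h.hasMFDerivAt).mfderiv
    rw [dirDeriv]
    exact congrArg (fun L ↦ L v) h2
  rw [extDerivOneForm, key, key, mlieBracket_chartField, map_zero]
  ring

end ChartFields

/-! ### Pull-back of 1-forms along maps from a normed space -/

section Pullback

variable {E M : Type*} [NormedAddCommGroup E] [NormedSpace ℝ E]
  [TopologicalSpace M] [ChartedSpace E M] [IsManifold 𝓘(ℝ, E) ∞ M]
  {W : Type*} [NormedAddCommGroup W] [NormedSpace ℝ W]

/-- The components of `G^* η`, for a map `G` from a normed space. -/
noncomputable def pullbackForm (η : ∀ x : M, TangentSpace 𝓘(ℝ, E) x →L[ℝ] ℝ) (G : W → M)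
    (v w : W) : ℝ :=
  η (G w) (mfderiv 𝓘(ℝ, W) 𝓘(ℝ, E) G w v)

theorem fderiv_extChartAt_comp {G : W → M} {x₀ : M} {w : W}
    (hG : MDifferentiableAt 𝓘(ℝ, W) 𝓘(ℝ, E) G w)
    (hw : G w ∈ (chartAt E x₀).source) (v : W) :
    fderiv ℝ (extChartAt 𝓘(ℝ, E) x₀ ∘ G) w v =
      mfderiv 𝓘(ℝ, E) 𝓘(ℝ, E) (extChartAt 𝓘(ℝ, E) x₀) (G w) (mfderiv 𝓘(ℝ, W) 𝓘(ℝ, E) G w v) := by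
  have : IsManifold 𝓘(ℝ, E) 1 M := IsManifold.of_le (n := ∞) (by simp)
  have h := mfderiv_comp w (mdifferentiableAt_extChartAt (I := 𝓘(ℝ, E)) hw) hG
  rw [mfderiv_eq_fderiv] at h
  exact congrArg (fun L ↦ L v) h

theorem chartField_fderiv {G : W → M} {x₀ : M} {w : W}
    (hG : MDifferentiableAt 𝓘(ℝ, W) 𝓘(ℝ, E) G w)
    (hw : G w ∈ (chartAt E x₀).source) (v : W) :
    chartField x₀ (fderiv ℝ (extChartAt 𝓘(ℝ, E) x₀ ∘ G) w v) (G w) =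
      mfderiv 𝓘(ℝ, W) 𝓘(ℝ, E) G w v := by
  rw [fderiv_extChartAt_comp hG hw]
  exact chartField_mfderiv_extChartAt hw _

theorem eventually_mdifferentiableAt {G : W → M} {w₀ : W}
    (hG : ContMDiffAt 𝓘(ℝ, W) 𝓘(ℝ, E) ∞ G w₀) :
    ∀ᶠ w in 𝓝 w₀, MDifferentiableAt 𝓘(ℝ, W) 𝓘(ℝ, E) G w := by
  have : IsManifold 𝓘(ℝ, E) 1 M := IsManifold.of_le (n := ∞) (by simp)
  -- At order `∞` the neighbourhood may shrink with the order of differentiability; a fixed finite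
  -- order holds on a whole neighbourhood.
  have h1 : ContMDiffAt 𝓘(ℝ, W) 𝓘(ℝ, E) 1 G w₀ := hG.of_le (by simp)
  filter_upwards [(contMDiffAt_iff_contMDiffAt_nhds (by simp)).1 h1] with w hw
  exact hw.mdifferentiableAt (by simp)

/-- Product rule for the components of `η` along `G` applied to the derivative of `G` in
coordinates. The second-derivative term is kept explicit because it is symmetric in `u` and `v` and
cancels on antisymmetrizing. -/
theorem hasFDerivAt_pullbackForm {η : ∀ x : M, TangentSpace 𝓘(ℝ, E) x →L[ℝ] ℝ} {G : W → M} {w₀ : W}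
    (hη : MDifferentiableAt 𝓘(ℝ, E) 𝓘(ℝ, E →L[ℝ] ℝ) (coordForm η (G w₀)) (G w₀))
    (hG : ContMDiffAt 𝓘(ℝ, W) 𝓘(ℝ, E) ∞ G w₀) (v : W) :
    ∃ L : W →L[ℝ] ℝ, HasFDerivAt (pullbackForm η G v) L w₀ ∧ ∀ u, L u =
      (show E →L[ℝ] ℝ from mfderiv 𝓘(ℝ, E) 𝓘(ℝ, E →L[ℝ] ℝ) (coordForm η (G w₀)) (G w₀)
        (mfderiv 𝓘(ℝ, W) 𝓘(ℝ, E) G w₀ u)) (fderiv ℝ (extChartAt 𝓘(ℝ, E) (G w₀) ∘ G) w₀ v) +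
      coordForm η (G w₀) (G w₀)
        (fderiv ℝ (fderiv ℝ (extChartAt 𝓘(ℝ, E) (G w₀) ∘ G)) w₀ u v) := by
  set x₀ := G w₀ with hx₀
  set Gc := extChartAt 𝓘(ℝ, E) x₀ ∘ G with hGc
  have hGd := eventually_mdifferentiableAt hG
  have h1 : HasFDerivAt (fun w ↦ coordForm η x₀ (G w))
      (show W →L[ℝ] (E →L[ℝ] ℝ) from
        (mfderiv 𝓘(ℝ, E) 𝓘(ℝ, E →L[ℝ] ℝ) (coordForm η x₀) x₀).comp
        (mfderiv 𝓘(ℝ, W) 𝓘(ℝ, E) G w₀)) w₀ :=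
    (hη.hasMFDerivAt.comp w₀ hGd.self_of_nhds.hasMFDerivAt).hasFDerivAt
  have hC : ContDiffAt ℝ ∞ Gc w₀ :=
    ((contMDiffAt_extChartAt (I := 𝓘(ℝ, E)) (n := ∞)).comp w₀ hG).contDiffAt
  have h2 : HasFDerivAt (fun w ↦ fderiv ℝ Gc w v)
      ((fderiv ℝ (fderiv ℝ Gc) w₀).flip v) w₀ := by
    have : DifferentiableAt ℝ (fderiv ℝ Gc) w₀ :=
      (hC.fderiv_right (m := 1) (by norm_cast)).differentiableAt (by simp)
    exact (ContinuousLinearMap.apply ℝ E v).hasFDerivAt.comp w₀ this.hasFDerivAt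
  have h3 := h1.clm_apply h2
  refine ⟨_, h3.congr_of_eventuallyEq ?_, fun u ↦ ?_⟩
  · have hs : ∀ᶠ w in 𝓝 w₀, G w ∈ (chartAt E x₀).source :=
      hG.continuousAt ((chartAt E x₀).open_source.mem_nhds (mem_chart_source E x₀))
    filter_upwards [hGd, hs] with w hw hsw
    rw [coordForm_apply, chartField_fderiv hw hsw]
    rfl
  · exact add_comm _ _

/-- The exterior derivative of a 1-form commutes with pull-back, evaluated on constant fields. -/
theorem fderiv_pullbackForm_sub {s : ℕ} (S : IndefiniteSStructure E M s) (α : Fin s) {G : W → M}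
    {w₀ : W} (hG : ContMDiffAt 𝓘(ℝ, W) 𝓘(ℝ, E) ∞ G w₀) (u v : W) :
    fderiv ℝ (pullbackForm (S.η α) G v) w₀ u - fderiv ℝ (pullbackForm (S.η α) G u) w₀ v =
      2 * S.g.val (G w₀) (mfderiv 𝓘(ℝ, W) 𝓘(ℝ, E) G w₀ u)
        (S.φ (G w₀) (mfderiv 𝓘(ℝ, W) 𝓘(ℝ, E) G w₀ v)) := by
  have hη := (contMDiffAt_coordForm (S.η_smooth α) (G w₀)).mdifferentiableAt (by simp)
  have hGd := (eventually_mdifferentiableAt hG).self_of_nhds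
  obtain ⟨L, hL, hL'⟩ := hasFDerivAt_pullbackForm hη hG v
  obtain ⟨K, hK, hK'⟩ := hasFDerivAt_pullbackForm hη hG u
  have hcf (a : W) := chartField_fderiv hGd (mem_chart_source E (G w₀)) a
  have hsymm := (((contMDiffAt_extChartAt (I := 𝓘(ℝ, E)) (n := ∞)).comp w₀ hG).contDiffAt
    |>.isSymmSndFDerivAt (by simpa using WithTop.coe_le_coe.2 (le_top (a := (2 : ℕ∞))))) u v
  -- Both vectors are extended to the ambient manifold as coordinate fields, so `G` need not be an
  -- immersion.
  have hd := S.dη_eq α _ _ _ (smoothFieldAt_chartField (G w₀)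
      (fderiv ℝ (extChartAt 𝓘(ℝ, E) (G w₀) ∘ G) w₀ u)) (smoothFieldAt_chartField (G w₀)
      (fderiv ℝ (extChartAt 𝓘(ℝ, E) (G w₀) ∘ G) w₀ v))
  have he := two_mul_extDerivOneForm_chartField (S.η α) (G w₀) hη
      (fderiv ℝ (extChartAt 𝓘(ℝ, E) (G w₀) ∘ G) w₀ u)
      (fderiv ℝ (extChartAt 𝓘(ℝ, E) (G w₀) ∘ G) w₀ v)
  rw [hd, hcf, hcf] at he
  rw [hL.fderiv, hK.fderiv, hL', hK', he, hsymm]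
  ring

end Pullback

/-! ### Functions with vanishing derivative -/

section LocallyConstant

variable {E N : Type*} [NormedAddCommGroup E] [NormedSpace ℝ E]
  [TopologicalSpace N] [ChartedSpace E N] [IsManifold 𝓘(ℝ, E) ∞ N]

theorem contMDiffAt_extChartAt_symm (p : N) {a : E} (ha : a ∈ (extChartAt 𝓘(ℝ, E) p).target) :
    ContMDiffAt 𝓘(ℝ, E) 𝓘(ℝ, E) ∞ (extChartAt 𝓘(ℝ, E) p).symm a :=
  (contMDiffOn_extChartAt_symm p).contMDiffAt ((isOpen_extChartAt_target p).mem_nhds ha)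

theorem hasMFDerivAt_zero_of_comp_extChartAt_symm {h : N → ℝ} {p : N}
    (hh : HasFDerivAt (h ∘ (extChartAt 𝓘(ℝ, E) p).symm) (0 : E →L[ℝ] ℝ) (extChartAt 𝓘(ℝ, E) p p)) :
    HasMFDerivAt 𝓘(ℝ, E) 𝓘(ℝ, ℝ) h p 0 := by
  have hN : IsManifold 𝓘(ℝ, E) 1 N := IsManifold.of_le (n := ∞) (by simp)
  have h2 := hh.hasMFDerivAt.comp p
    (mdifferentiableAt_extChartAt (I := 𝓘(ℝ, E)) (mem_chart_source E p)).hasMFDerivAt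
  have h3 := h2.congr_of_eventuallyEq (f₁ := h) (by
    filter_upwards [extChartAt_source_mem_nhds (I := 𝓘(ℝ, E)) p] with q hq
    exact congrArg h ((extChartAt 𝓘(ℝ, E) p).left_inv hq).symm)
  exact h3.congr_mfderiv (ContinuousLinearMap.zero_comp _)

/-- In a chart the function is constant on a ball around the image of each point; hence it is
locally constant, and preconnectedness concludes. -/
theorem eq_of_hasMFDerivAt_zero [PreconnectedSpace N] {h : N → ℝ}
    (hh : ∀ p, HasMFDerivAt 𝓘(ℝ, E) 𝓘(ℝ, ℝ) h p 0) (p p' : N) : h p = h p' := by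
  refine IsLocallyConstant.apply_eq_of_preconnectedSpace ?_ p p'
  rw [IsLocallyConstant.iff_eventually_eq]
  intro p
  obtain ⟨r, hr, hball⟩ := Metric.mem_nhds_iff.1 (extChartAt_target_mem_nhds (I := 𝓘(ℝ, E)) p)
  have hd (a : E) (ha : a ∈ Metric.ball (extChartAt 𝓘(ℝ, E) p p) r) :
      HasFDerivAt (h ∘ (extChartAt 𝓘(ℝ, E) p).symm) (0 : E →L[ℝ] ℝ) a := by
    have h1 := (hh ((extChartAt 𝓘(ℝ, E) p).symm a)).comp a
      ((contMDiffAt_extChartAt_symm p (hball ha)).mdifferentiableAt (by simp)).hasMFDerivAt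
    exact (h1.congr_mfderiv (ContinuousLinearMap.zero_comp _)).hasFDerivAt
  have hs : (extChartAt 𝓘(ℝ, E) p) ⁻¹' Metric.ball (extChartAt 𝓘(ℝ, E) p p) r ∈ 𝓝 p :=
    (continuousAt_extChartAt p).preimage_mem_nhds (Metric.ball_mem_nhds _ hr)
  filter_upwards [hs, extChartAt_source_mem_nhds (I := 𝓘(ℝ, E)) p] with q hq hqs
  have := Metric.isOpen_ball.is_const_of_fderiv_eq_zero (𝕜 := ℝ)
    (convex_ball (extChartAt 𝓘(ℝ, E) p p) r).isPreconnected
    (fun a ha ↦ (hd a ha).differentiableAt.differentiableWithinAt)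
    (fun a ha ↦ (hd a ha).fderiv) hq (Metric.mem_ball_self hr)
  rwa [Function.comp_apply, Function.comp_apply, (extChartAt 𝓘(ℝ, E) p).left_inv hqs,
    extChartAt_to_inv] at this

end LocallyConstant

/-! ### Metric duality between `η^α` and `ξ_α` -/

section Structure

variable {E M : Type*} [NormedAddCommGroup E] [NormedSpace ℝ E]
  [TopologicalSpace M] [ChartedSpace E M] [IsManifold 𝓘(ℝ, E) ∞ M] {s : ℕ}

/-- With `ξ_α` in the second slot of the compatibility identity, the left side vanishes because `φ
ξ_α = 0` and only one term of the sum survives. -/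
theorem IndefiniteGFFStructure.ε_mul_η (S : IndefiniteGFFStructure E M s) (α : Fin s) (x : M)
    (v : TangentSpace 𝓘(ℝ, E) x) : S.ε α * S.η α x v = S.g.val x v (S.ξ α x) := by
  have h := S.compatible x v (S.ξ α x)
  rw [S.φ_ξ, map_zero] at h
  simp only [S.η_ξ, mul_ite, mul_one, mul_zero, Finset.sum_ite_eq', Finset.mem_univ, if_true] at h
  linarith

theorem IndefiniteGFFStructure.ε_ne_zero (S : IndefiniteGFFStructure E M s) (α : Fin s) :
    S.ε α ≠ 0 := by
  rcases S.ε_eq α with h | h <;> simp [h]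

theorem IndefiniteGFFStructure.η_eq_zero (S : IndefiniteGFFStructure E M s) {α : Fin s} {x : M}
    {v : TangentSpace 𝓘(ℝ, E) x} (h : S.g.val x v (S.ξ α x) = 0) : S.η α x v = 0 :=
  (mul_eq_zero.1 ((S.ε_mul_η α x v).trans h)).resolve_left (S.ε_ne_zero α)

end Structure

/-! ### Slices of a map from a product, and their derivatives in charts -/

section ProductMaps

variable {E M : Type*} [NormedAddCommGroup E] [NormedSpace ℝ E]
  [TopologicalSpace M] [ChartedSpace E M]
  {E₁ N₁ : Type*} [NormedAddCommGroup E₁] [NormedSpace ℝ E₁]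
  [TopologicalSpace N₁] [ChartedSpace E₁ N₁]
  {E₂ N₂ : Type*} [NormedAddCommGroup E₂] [NormedSpace ℝ E₂]
  [TopologicalSpace N₂] [ChartedSpace E₂ N₂]

variable (ι : N₁ × N₂ → M) (p₀ : N₁) (q₀ : N₂)

/-- The map `ι` read in the preferred charts of the factors. -/
noncomputable def inCharts (w : E₁ × E₂) : M :=
  ι ((extChartAt 𝓘(ℝ, E₁) p₀).symm w.1, (extChartAt 𝓘(ℝ, E₂) q₀).symm w.2)

variable {ι p₀ q₀}

theorem mdifferentiableAt_slice_left (hι : ContMDiff (𝓘(ℝ, E₁).prod 𝓘(ℝ, E₂)) 𝓘(ℝ, E) ∞ ι)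
    (p : N₁) (q : N₂) : MDifferentiableAt 𝓘(ℝ, E₁) 𝓘(ℝ, E) (fun p ↦ ι (p, q)) p :=
  (hι.comp (contMDiff_id.prodMk contMDiff_const)).mdifferentiableAt (by simp)

theorem mdifferentiableAt_slice_right (hι : ContMDiff (𝓘(ℝ, E₁).prod 𝓘(ℝ, E₂)) 𝓘(ℝ, E) ∞ ι)
    (p : N₁) (q : N₂) : MDifferentiableAt 𝓘(ℝ, E₂) 𝓘(ℝ, E) (fun q ↦ ι (p, q)) q :=
  (hι.comp (contMDiff_const.prodMk contMDiff_id)).mdifferentiableAt (by simp)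

theorem mfderiv_slice_left (hι : ContMDiff (𝓘(ℝ, E₁).prod 𝓘(ℝ, E₂)) 𝓘(ℝ, E) ∞ ι)
    (p : N₁) (q : N₂) (v : TangentSpace 𝓘(ℝ, E₁) p) :
    mfderiv 𝓘(ℝ, E₁) 𝓘(ℝ, E) (fun p ↦ ι (p, q)) p v =
      mfderiv (𝓘(ℝ, E₁).prod 𝓘(ℝ, E₂)) 𝓘(ℝ, E) ι (p, q) (v, (0 : E₂)) := by
  have h := mfderiv_comp (I := 𝓘(ℝ, E₁)) (f := fun p : N₁ ↦ (p, q)) p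
    (hι.mdifferentiableAt (by simp) (x := (p, q)))
    (mdifferentiableAt_id.prodMk mdifferentiableAt_const)
  rw [mfderiv_prod_left] at h
  exact congrArg (fun L ↦ L v) h

theorem mfderiv_slice_right (hι : ContMDiff (𝓘(ℝ, E₁).prod 𝓘(ℝ, E₂)) 𝓘(ℝ, E) ∞ ι)
    (p : N₁) (q : N₂) (v : TangentSpace 𝓘(ℝ, E₂) q) :
    mfderiv 𝓘(ℝ, E₂) 𝓘(ℝ, E) (fun q ↦ ι (p, q)) q v =
      mfderiv (𝓘(ℝ, E₁).prod 𝓘(ℝ, E₂)) 𝓘(ℝ, E) ι (p, q) ((0 : E₁), v) := by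
  have h := mfderiv_comp (I := 𝓘(ℝ, E₂)) (f := fun q : N₂ ↦ (p, q)) q
    (hι.mdifferentiableAt (by simp) (x := (p, q)))
    (mdifferentiableAt_const.prodMk mdifferentiableAt_id)
  rw [mfderiv_prod_right] at h
  exact congrArg (fun L ↦ L v) h

variable [IsManifold 𝓘(ℝ, E₁) ∞ N₁] [IsManifold 𝓘(ℝ, E₂) ∞ N₂]

theorem contMDiffAt_inCharts (hι : ContMDiff (𝓘(ℝ, E₁).prod 𝓘(ℝ, E₂)) 𝓘(ℝ, E) ∞ ι) {w : E₁ × E₂}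
    (h₁ : w.1 ∈ (extChartAt 𝓘(ℝ, E₁) p₀).target) (h₂ : w.2 ∈ (extChartAt 𝓘(ℝ, E₂) q₀).target) :
    ContMDiffAt 𝓘(ℝ, E₁ × E₂) 𝓘(ℝ, E) ∞ (inCharts ι p₀ q₀) w :=
  (hι _).comp w
    (((contMDiffAt_extChartAt_symm p₀ h₁).comp w contDiff_fst.contMDiff.contMDiffAt).prodMk
    ((contMDiffAt_extChartAt_symm q₀ h₂).comp w contDiff_snd.contMDiff.contMDiffAt))

theorem mfderiv_inCharts_left (hι : ContMDiff (𝓘(ℝ, E₁).prod 𝓘(ℝ, E₂)) 𝓘(ℝ, E) ∞ ι) {w : E₁ × E₂}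
    (h₁ : w.1 ∈ (extChartAt 𝓘(ℝ, E₁) p₀).target) (h₂ : w.2 ∈ (extChartAt 𝓘(ℝ, E₂) q₀).target)
    (v : E₁) :
    mfderiv 𝓘(ℝ, E₁ × E₂) 𝓘(ℝ, E) (inCharts ι p₀ q₀) w (v, (0 : E₂)) =
      mfderiv 𝓘(ℝ, E₁) 𝓘(ℝ, E) (fun p ↦ ι (p, (extChartAt 𝓘(ℝ, E₂) q₀).symm w.2))
        ((extChartAt 𝓘(ℝ, E₁) p₀).symm w.1)
        (mfderiv 𝓘(ℝ, E₁) 𝓘(ℝ, E₁) (extChartAt 𝓘(ℝ, E₁) p₀).symm w.1 v) := by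
  have hG := (contMDiffAt_inCharts hι h₁ h₂).mdifferentiableAt (by simp)
  have hi : HasMFDerivAt 𝓘(ℝ, E₁) 𝓘(ℝ, E₁ × E₂) (fun a : E₁ ↦ (a, w.2)) w.1
      (ContinuousLinearMap.inl ℝ E₁ E₂) := (hasFDerivAt_prodMk_left w.1 w.2).hasMFDerivAt
  have h3 := (HasMFDerivAt.comp w.1 (g := inCharts ι p₀ q₀) hG.hasMFDerivAt hi).mfderiv
  have h4 := (HasMFDerivAt.comp w.1
    (mdifferentiableAt_slice_left hι _ ((extChartAt 𝓘(ℝ, E₂) q₀).symm w.2)).hasMFDerivAt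
    ((contMDiffAt_extChartAt_symm p₀ h₁).mdifferentiableAt (by simp)).hasMFDerivAt).mfderiv
  exact congrArg (fun L ↦ L v) (h3.symm.trans h4)

theorem mfderiv_inCharts_right (hι : ContMDiff (𝓘(ℝ, E₁).prod 𝓘(ℝ, E₂)) 𝓘(ℝ, E) ∞ ι) {w : E₁ × E₂}
    (h₁ : w.1 ∈ (extChartAt 𝓘(ℝ, E₁) p₀).target) (h₂ : w.2 ∈ (extChartAt 𝓘(ℝ, E₂) q₀).target)
    (v : E₂) :
    mfderiv 𝓘(ℝ, E₁ × E₂) 𝓘(ℝ, E) (inCharts ι p₀ q₀) w ((0 : E₁), v) =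
      mfderiv 𝓘(ℝ, E₂) 𝓘(ℝ, E) (fun q ↦ ι ((extChartAt 𝓘(ℝ, E₁) p₀).symm w.1, q))
        ((extChartAt 𝓘(ℝ, E₂) q₀).symm w.2)
        (mfderiv 𝓘(ℝ, E₂) 𝓘(ℝ, E₂) (extChartAt 𝓘(ℝ, E₂) q₀).symm w.2 v) := by
  have hG := (contMDiffAt_inCharts hι h₁ h₂).mdifferentiableAt (by simp)
  have hi : HasMFDerivAt 𝓘(ℝ, E₂) 𝓘(ℝ, E₁ × E₂) (fun b : E₂ ↦ (w.1, b)) w.2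
      (ContinuousLinearMap.inr ℝ E₁ E₂) := (hasFDerivAt_prodMk_right w.1 w.2).hasMFDerivAt
  have h3 := (HasMFDerivAt.comp w.2 (g := inCharts ι p₀ q₀) hG.hasMFDerivAt hi).mfderiv
  have h4 := (HasMFDerivAt.comp w.2
    (mdifferentiableAt_slice_right hι ((extChartAt 𝓘(ℝ, E₁) p₀).symm w.1) _).hasMFDerivAt
    ((contMDiffAt_extChartAt_symm q₀ h₂).mdifferentiableAt (by simp)).hasMFDerivAt).mfderiv
  exact congrArg (fun L ↦ L v) (h3.symm.trans h4)

end ProductMaps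

/-! ### Warped product CR-submanifolds -/

section WarpedProducts

variable {E M : Type*} [NormedAddCommGroup E] [NormedSpace ℝ E]
  [TopologicalSpace M] [ChartedSpace E M] [IsManifold 𝓘(ℝ, E) ∞ M] {s : ℕ}
  {E₁ N₁ : Type*} [NormedAddCommGroup E₁] [NormedSpace ℝ E₁]
  [TopologicalSpace N₁] [ChartedSpace E₁ N₁] [IsManifold 𝓘(ℝ, E₁) ∞ N₁]
  {E₂ N₂ : Type*} [NormedAddCommGroup E₂] [NormedSpace ℝ E₂]
  [TopologicalSpace N₂] [ChartedSpace E₂ N₂] [IsManifold 𝓘(ℝ, E₂) ∞ N₂]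

section Metric

variable {g : SemiRiemannianMetric E M} {g₁ : SemiRiemannianMetric E₁ N₁}
  {g₂ : SemiRiemannianMetric E₂ N₂} {f : N₁ → ℝ} {ι : N₁ × N₂ → M}

theorem IsWarpedProductSubmanifold.val_right_right (h : IsWarpedProductSubmanifold g g₁ g₂ f ι)
    (p : N₁) (q : N₂) (v w : TangentSpace 𝓘(ℝ, E₂) q) :
    g.val (ι (p, q)) (mfderiv 𝓘(ℝ, E₂) 𝓘(ℝ, E) (fun q ↦ ι (p, q)) q v)
      (mfderiv 𝓘(ℝ, E₂) 𝓘(ℝ, E) (fun q ↦ ι (p, q)) q w) = f p ^ 2 * g₂.val q v w := by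
  rw [mfderiv_slice_right h.ι_smooth, mfderiv_slice_right h.ι_smooth]
  refine (h.isometric p q 0 0 v w).trans ?_
  rw [map_zero, zero_add]

theorem IsWarpedProductSubmanifold.val_left_right (h : IsWarpedProductSubmanifold g g₁ g₂ f ι)
    (p : N₁) (q : N₂) (v : TangentSpace 𝓘(ℝ, E₁) p) (w : TangentSpace 𝓘(ℝ, E₂) q) :
    g.val (ι (p, q)) (mfderiv 𝓘(ℝ, E₁) 𝓘(ℝ, E) (fun p ↦ ι (p, q)) p v)
      (mfderiv 𝓘(ℝ, E₂) 𝓘(ℝ, E) (fun q ↦ ι (p, q)) q w) = 0 := by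
  rw [mfderiv_slice_left h.ι_smooth, mfderiv_slice_right h.ι_smooth]
  refine (h.isometric p q v 0 0 w).trans ?_
  rw [map_zero, map_zero]
  simp

end Metric

variable {S : IndefiniteSStructure E M s} {g₁ : SemiRiemannianMetric E₁ N₁}
  {g₂ : SemiRiemannianMetric E₂ N₂} {f : N₁ → ℝ} {ι : N₁ × N₂ → M} {α : Fin s}

/-- The factors are orthogonal, and `η^α` is dual to a vector tangent to `N₂`. -/
theorem IsWarpedProductSubmanifold.η_left_eq_zero (h : IsWarpedProductSubmanifold S.g g₁ g₂ f ι)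
    (hα : ∀ p : N₁, IsTangentTo (F := E₂) (fun q ↦ ι (p, q)) (S.ξ α))
    (p : N₁) (q : N₂) (v : TangentSpace 𝓘(ℝ, E₁) p) :
    S.η α (ι (p, q)) (mfderiv 𝓘(ℝ, E₁) 𝓘(ℝ, E) (fun p ↦ ι (p, q)) p v) = 0 := by
  obtain ⟨u, hu⟩ := hα p q
  refine S.η_eq_zero ?_
  rw [← hu]
  exact h.val_left_right p q v u

theorem IsWarpedProductSubmanifold.η_right_eq_zero (h : IsWarpedProductSubmanifold S.g g₁ g₂ f ι)
    (hα : ∀ q : N₂, IsTangentTo (F := E₁) (fun p ↦ ι (p, q)) (S.ξ α))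
    (p : N₁) (q : N₂) (v : TangentSpace 𝓘(ℝ, E₂) q) :
    S.η α (ι (p, q)) (mfderiv 𝓘(ℝ, E₂) 𝓘(ℝ, E) (fun q ↦ ι (p, q)) q v) = 0 := by
  obtain ⟨u, hu⟩ := hα q p
  refine S.η_eq_zero ?_
  rw [← hu, S.g.symm]
  exact h.val_left_right p q u v

/-- If `ξ_α` is tangent to `N₂`, then the value of `η^α` on a fixed vector tangent to `N₂` has zero
derivative along `N₁`. -/
theorem IsWarpedProductCRSubmanifold.hasMFDerivAt_η_right
    (h : IsWarpedProductCRSubmanifold S g₁ g₂ f ι)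
    (hα : ∀ p : N₁, IsTangentTo (F := E₂) (fun q ↦ ι (p, q)) (S.ξ α))
    (p₀ : N₁) (q : N₂) (x : TangentSpace 𝓘(ℝ, E₂) q) :
    HasMFDerivAt 𝓘(ℝ, E₁) 𝓘(ℝ, ℝ)
      (fun p ↦ S.η α (ι (p, q)) (mfderiv 𝓘(ℝ, E₂) 𝓘(ℝ, E) (fun q ↦ ι (p, q)) q x)) p₀ 0 := by
  have hι := h.ι_smooth
  set G : E₁ × E₂ → M := inCharts ι p₀ q with hGdef
  set b₀ : E₂ := extChartAt 𝓘(ℝ, E₂) q q with hb₀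
  set a₀ : E₁ := extChartAt 𝓘(ℝ, E₁) p₀ p₀ with ha₀
  have ha₀t : a₀ ∈ (extChartAt 𝓘(ℝ, E₁) p₀).target := mem_extChartAt_target p₀
  have hb₀t : b₀ ∈ (extChartAt 𝓘(ℝ, E₂) q).target := mem_extChartAt_target q
  have hN₂ : IsManifold 𝓘(ℝ, E₂) 1 N₂ := IsManifold.of_le (n := ∞) (by simp)
  have hM : IsManifold 𝓘(ℝ, E) 1 M := IsManifold.of_le (n := ∞) (by simp)
  let x' : E₂ := x
  -- At its own base point the preferred chart has identity derivative, under the identification of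
  -- the tangent space with the model space.
  have hx : mfderiv 𝓘(ℝ, E₂) 𝓘(ℝ, E₂) (extChartAt 𝓘(ℝ, E₂) q).symm b₀ x' = x := by
    have := mfderivWithin_range_extChartAt_symm (I := 𝓘(ℝ, E₂)) (x := q)
    rw [ModelWithCorners.range_eq_univ, mfderivWithin_univ] at this
    exact congrArg (fun L ↦ L x) this
  have hG : ContMDiffAt 𝓘(ℝ, E₁ × E₂) 𝓘(ℝ, E) ∞ G (a₀, b₀) := contMDiffAt_inCharts hι ha₀t hb₀t
  have hη := (contMDiffAt_coordForm (S.η_smooth α) (G (a₀, b₀))).mdifferentiableAt (by simp)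
  obtain ⟨L, hL, -⟩ := hasFDerivAt_pullbackForm hη hG ((0 : E₁), x')
  -- The chart followed by its inverse returns `q` only up to a propositional equality, so the
  -- tangent vector has to be transported.
  have hcongr (q' : N₂) (hq' : q' = q) (y : TangentSpace 𝓘(ℝ, E₂) q') (hy : (y : E₂) = x) (p : N₁) :
      S.η α (ι (p, q')) (mfderiv 𝓘(ℝ, E₂) 𝓘(ℝ, E) (fun q ↦ ι (p, q)) q' y) =
      S.η α (ι (p, q)) (mfderiv 𝓘(ℝ, E₂) 𝓘(ℝ, E) (fun q ↦ ι (p, q)) q x) := by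
    subst hq'
    exact congrArg _ (congrArg _ hy)
  have hval (a : E₁) (ha : a ∈ (extChartAt 𝓘(ℝ, E₁) p₀).target) :
      pullbackForm (S.η α) G ((0 : E₁), x') (a, b₀) =
        S.η α (ι ((extChartAt 𝓘(ℝ, E₁) p₀).symm a, q))
          (mfderiv 𝓘(ℝ, E₂) 𝓘(ℝ, E) (fun q ↦ ι ((extChartAt 𝓘(ℝ, E₁) p₀).symm a, q)) q x) := by
    rw [pullbackForm, mfderiv_inCharts_right hι ha hb₀t]
    exact hcongr _ (extChartAt_to_inv q) _ hx _
  have hzero (v : E₁) : pullbackForm (S.η α) G (v, (0 : E₂)) =ᶠ[𝓝 (a₀, b₀)] fun _ ↦ 0 := by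
    filter_upwards [prod_mem_nhds ((isOpen_extChartAt_target p₀).mem_nhds ha₀t)
      ((isOpen_extChartAt_target q).mem_nhds hb₀t)] with w hw
    rw [pullbackForm, mfderiv_inCharts_left hι hw.1 hw.2]
    exact h.η_left_eq_zero hα _ _ _
  -- Here `dη^α(v, x) = g(v, φ x) = 0`, since invariance keeps `φ x` tangent to `N₂`; the other
  -- derivative vanishes by `hzero`.
  have hL0 (v : E₁) : L (v, 0) = 0 := by
    have hd := fderiv_pullbackForm_sub S α hG (v, (0 : E₂)) ((0 : E₁), x')
    rw [(hzero v).fderiv_eq, hL.fderiv, mfderiv_inCharts_left hι ha₀t hb₀t,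
      mfderiv_inCharts_right hι ha₀t hb₀t] at hd
    obtain ⟨w, hw⟩ := h.invariant ((extChartAt 𝓘(ℝ, E₁) p₀).symm a₀)
      ((extChartAt 𝓘(ℝ, E₂) q).symm b₀)
      (mfderiv 𝓘(ℝ, E₂) 𝓘(ℝ, E₂) (extChartAt 𝓘(ℝ, E₂) q).symm b₀ x')
    have ho := h.val_left_right ((extChartAt 𝓘(ℝ, E₁) p₀).symm a₀)
      ((extChartAt 𝓘(ℝ, E₂) q).symm b₀)
      (mfderiv 𝓘(ℝ, E₁) 𝓘(ℝ, E₁) (extChartAt 𝓘(ℝ, E₁) p₀).symm a₀ v) w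
    rw [hw] at ho
    have hd' := hd.trans ((congrArg (2 * ·) ho).trans (mul_zero 2))
    simpa using hd'
  refine hasMFDerivAt_zero_of_comp_extChartAt_symm ?_
  have hc := HasFDerivAt.comp a₀ hL (hasFDerivAt_prodMk_left (𝕜 := ℝ) a₀ b₀)
  rw [show L.comp (ContinuousLinearMap.inl ℝ E₁ E₂) = 0 from
    ContinuousLinearMap.ext fun v ↦ hL0 v] at hc
  refine hc.congr_of_eventuallyEq ?_
  filter_upwards [(isOpen_extChartAt_target p₀).mem_nhds ha₀t] with a ha
  exact (hval a ha).symm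

/-- Let `u` and `u'` represent `ξ_α` at `p` and `p'`. Constancy of `η^α` along `N₁`, tested on `u`
and on `u'`, gives `ε_α = f(p')² g₂(u, u')` and `f(p)² g₂(u, u') = ε_α`. As `ε_α ≠ 0`, the common
factor cancels. -/
theorem IsWarpedProductCRSubmanifold.warping_eq [PreconnectedSpace N₁] [Nonempty N₂]
    (h : IsWarpedProductCRSubmanifold S g₁ g₂ f ι)
    (hα : ∀ p : N₁, IsTangentTo (F := E₂) (fun q ↦ ι (p, q)) (S.ξ α)) (p p' : N₁) : f p = f p' := by
  obtain ⟨q⟩ := ‹Nonempty N₂›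
  obtain ⟨u, hu⟩ := hα p q
  obtain ⟨u', hu'⟩ := hα p' q
  have hconst (x : TangentSpace 𝓘(ℝ, E₂) q) :
      f p ^ 2 * g₂.val q x u = f p' ^ 2 * g₂.val q x u' := by
    rw [← h.val_right_right, ← h.val_right_right, hu, hu']
    refine (S.ε_mul_η α _ _).symm.trans (.trans ?_ (S.ε_mul_η α _ _))
    exact congrArg _ (eq_of_hasMFDerivAt_zero (fun p ↦ h.hasMFDerivAt_η_right hα p q x) p p')
  have hε (p : N₁) : S.g.val (ι (p, q)) (S.ξ α (ι (p, q))) (S.ξ α (ι (p, q))) = S.ε α := by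
    rw [← S.ε_mul_η, S.η_ξ, if_pos rfl, mul_one]
  have h1 : f p ^ 2 * g₂.val q u u = S.ε α := by
    rw [← h.val_right_right, hu]
    exact hε p
  have h2 : f p' ^ 2 * g₂.val q u' u' = S.ε α := by
    rw [← h.val_right_right, hu']
    exact hε p'
  have h3 := hconst u
  have h4 := hconst u'
  rw [g₂.symm q u' u, h2] at h4
  rw [h1] at h3
  have hne : g₂.val q u u' ≠ 0 := fun h0 ↦ S.ε_ne_zero α (by rw [h3, h0, mul_zero])
  have hsq : f p ^ 2 = f p' ^ 2 := mul_right_cancel₀ hne (h4.trans h3)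
  exact (pow_left_inj₀ (h.f_pos p).le (h.f_pos p').le two_ne_zero).1 hsq

/-- If `ξ_α` is tangent to `N₁`, then the fundamental 2-form vanishes on `N₂`. -/
theorem IsWarpedProductCRSubmanifold.val_φ_eq_zero
    (h : IsWarpedProductCRSubmanifold S g₁ g₂ f ι)
    (hα : ∀ q : N₂, IsTangentTo (F := E₁) (fun p ↦ ι (p, q)) (S.ξ α))
    (p : N₁) (q : N₂) (x y : TangentSpace 𝓘(ℝ, E₂) q) :
    S.g.val (ι (p, q)) (mfderiv 𝓘(ℝ, E₂) 𝓘(ℝ, E) (fun q ↦ ι (p, q)) q x)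
      (S.φ (ι (p, q)) (mfderiv 𝓘(ℝ, E₂) 𝓘(ℝ, E) (fun q ↦ ι (p, q)) q y)) = 0 := by
  have hι := h.ι_smooth
  set a₀ : E₁ := extChartAt 𝓘(ℝ, E₁) p p with ha₀
  set b₀ : E₂ := extChartAt 𝓘(ℝ, E₂) q q with hb₀
  have ha₀t : a₀ ∈ (extChartAt 𝓘(ℝ, E₁) p).target := mem_extChartAt_target p
  have hb₀t : b₀ ∈ (extChartAt 𝓘(ℝ, E₂) q).target := mem_extChartAt_target q
  have hN₂ : IsManifold 𝓘(ℝ, E₂) 1 N₂ := IsManifold.of_le (n := ∞) (by simp)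
  have hx (x : E₂) : mfderiv 𝓘(ℝ, E₂) 𝓘(ℝ, E₂) (extChartAt 𝓘(ℝ, E₂) q).symm b₀ x = x := by
    have := mfderivWithin_range_extChartAt_symm (I := 𝓘(ℝ, E₂)) (x := q)
    rw [ModelWithCorners.range_eq_univ, mfderivWithin_univ] at this
    exact congrArg (fun L ↦ L x) this
  have hG := contMDiffAt_inCharts hι (w := (a₀, b₀)) ha₀t hb₀t
  -- The pulled-back form vanishes on `N₂`-directions in a whole neighbourhood, so both derivatives
  -- in the formula for `dη^α` are zero.
  have hzero (v : E₂) :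
      pullbackForm (S.η α) (inCharts (E₁ := E₁) (E₂ := E₂) ι p q) ((0 : E₁), v)
        =ᶠ[𝓝 (a₀, b₀)] fun _ ↦ 0 := by
    filter_upwards [prod_mem_nhds ((isOpen_extChartAt_target p).mem_nhds ha₀t)
      ((isOpen_extChartAt_target q).mem_nhds hb₀t)] with w hw
    rw [pullbackForm, mfderiv_inCharts_right hι hw.1 hw.2]
    exact h.η_right_eq_zero hα _ _ _
  have hd := fderiv_pullbackForm_sub S α hG ((0 : E₁), (show E₂ from x))
    ((0 : E₁), (show E₂ from y))
  rw [(hzero _).fderiv_eq, (hzero _).fderiv_eq, mfderiv_inCharts_right hι ha₀t hb₀t,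
      mfderiv_inCharts_right hι ha₀t hb₀t] at hd
  have hcongr (p' : N₁) (hp' : p' = p) (q' : N₂) (hq' : q' = q) (x' y' : TangentSpace 𝓘(ℝ, E₂) q')
      (hx' : (x' : E₂) = x) (hy' : (y' : E₂) = y)
      (h0 : S.g.val (ι (p', q')) (mfderiv 𝓘(ℝ, E₂) 𝓘(ℝ, E) (fun q ↦ ι (p', q)) q' x')
      (S.φ (ι (p', q')) (mfderiv 𝓘(ℝ, E₂) 𝓘(ℝ, E) (fun q ↦ ι (p', q)) q' y')) = 0) :
      S.g.val (ι (p, q)) (mfderiv 𝓘(ℝ, E₂) 𝓘(ℝ, E) (fun q ↦ ι (p, q)) q x)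
      (S.φ (ι (p, q)) (mfderiv 𝓘(ℝ, E₂) 𝓘(ℝ, E) (fun q ↦ ι (p, q)) q y)) = 0 := by
    subst hp' hq'
    obtain rfl : x' = x := hx'
    obtain rfl : y' = y := hy'
    exact h0
  refine hcongr _ (extChartAt_to_inv (I := 𝓘(ℝ, E₁)) p) _ (extChartAt_to_inv (I := 𝓘(ℝ, E₂)) q) _ _
    (hx x) (hx y) ?_
  refine (mul_eq_zero.1 (hd.symm.trans ?_)).resolve_left two_ne_zero
  simp

/-- The vectors `ξ_α` cannot all be tangent to `N₁`. -/
theorem IsWarpedProductCRSubmanifold.exists_ξ_tangent_right [Nonempty N₁] [Nonempty N₂]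
    (h : IsWarpedProductCRSubmanifold S g₁ g₂ f ι) (hs : 0 < s)
    (hdim : 0 < Module.finrank ℝ E₂) :
    ∃ α, ∀ p : N₁, IsTangentTo (F := E₂) (fun q ↦ ι (p, q)) (S.ξ α) := by
  by_contra! hcon
  have hleft (α : Fin s) : ∀ q : N₂, IsTangentTo (F := E₁) (fun p ↦ ι (p, q)) (S.ξ α) :=
    (h.ξ_tangent α).resolve_left fun hα ↦ (hcon α).elim fun p hp ↦ hp (hα p)
  obtain ⟨p⟩ := ‹Nonempty N₁›
  obtain ⟨q⟩ := ‹Nonempty N₂›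
  have : Nontrivial E₂ := Module.nontrivial_of_finrank_pos hdim
  obtain ⟨y, hy⟩ := exists_ne (0 : E₂)
  let y' : TangentSpace 𝓘(ℝ, E₂) q := y
  have hf : f p ^ 2 ≠ 0 := (pow_pos (h.f_pos p) 2).ne'
  obtain ⟨w, hw⟩ := h.invariant p q y'
  -- The vector `w` represents `φ y`, and `Φ = 0` on `N₂` makes it `g₂`-orthogonal to everything.
  have hw0 : w = 0 := by
    refine g₂.nondegenerate q w fun x ↦ ?_
    have h0 := h.val_φ_eq_zero (hleft ⟨0, hs⟩) p q x y'
    have h1 := h.val_right_right p q x w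
    rw [hw] at h1
    rw [g₂.symm]
    exact (mul_eq_zero.1 (h1.symm.trans h0)).resolve_left hf
  have hφ : S.φ (ι (p, q)) (mfderiv 𝓘(ℝ, E₂) 𝓘(ℝ, E) (fun q ↦ ι (p, q)) q y') = 0 := by
    rw [← hw, hw0, map_zero]
  have hsq := S.φ_sq (ι (p, q)) (mfderiv 𝓘(ℝ, E₂) 𝓘(ℝ, E) (fun q ↦ ι (p, q)) q y')
  have hη (α : Fin s) := h.η_right_eq_zero (hleft α) p q y'
  have hdy : mfderiv 𝓘(ℝ, E₂) 𝓘(ℝ, E) (fun q ↦ ι (p, q)) q y' = 0 := by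
    rw [hφ, map_zero, Finset.sum_eq_zero fun α _ ↦ by rw [hη α, zero_smul], add_zero] at hsq
    exact neg_eq_zero.1 hsq.symm
  refine hy (g₂.nondegenerate q y' fun x ↦ ?_)
  have h1 := h.val_right_right p q y' x
  rw [hdy, map_zero] at h1
  exact (mul_eq_zero.1 h1.symm).resolve_left hf

end WarpedProducts

/-! ### The main theorem -/

theorem theorem3p2
    {E M : Type*} [NormedAddCommGroup E] [NormedSpace ℝ E] [FiniteDimensional ℝ E]
    [TopologicalSpace M] [T2Space M] [SecondCountableTopology M]
    [ChartedSpace E M] [IsManifold 𝓘(ℝ, E) ∞ M]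
    {s : ℕ} (hs : 0 < s) (S : IndefiniteSStructure E M s)
    {E₁ N₁ : Type*} [NormedAddCommGroup E₁] [NormedSpace ℝ E₁] [FiniteDimensional ℝ E₁]
    [TopologicalSpace N₁] [T2Space N₁] [SecondCountableTopology N₁] [ConnectedSpace N₁]
    [ChartedSpace E₁ N₁] [IsManifold 𝓘(ℝ, E₁) ∞ N₁]
    {E₂ N₂ : Type*} [NormedAddCommGroup E₂] [NormedSpace ℝ E₂] [FiniteDimensional ℝ E₂]
    [TopologicalSpace N₂] [T2Space N₂] [SecondCountableTopology N₂] [Nonempty N₂]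
    [ChartedSpace E₂ N₂] [IsManifold 𝓘(ℝ, E₂) ∞ N₂]
    (hdim : 0 < Module.finrank ℝ E₂)
    (g₁ : SemiRiemannianMetric E₁ N₁) (g₂ : SemiRiemannianMetric E₂ N₂)
    (f : N₁ → ℝ) (ι : N₁ × N₂ → M)
    (hM : IsWarpedProductCRSubmanifold S g₁ g₂ f ι) :
    ∃ (c : ℝ) (hc : 0 < c), (∀ p, f p = c) ∧
      IsCRProduct S g₁ (g₂.scale (c ^ 2) (pow_pos hc 2).ne') ι ∧
      (((∀ α, ∀ p, IsTangentTo (F := E₂) (fun q ↦ ι (p, q)) (S.ξ α)) ∨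
          (∀ α, ∀ q, IsTangentTo (F := E₁) (fun p ↦ ι (p, q)) (S.ξ α))) →
        IsContactCRProduct S g₁ (g₂.scale (c ^ 2) (pow_pos hc 2).ne') ι) := by

  obtain ⟨β, hβ⟩ := hM.exists_ξ_tangent_right hs hdim
  obtain ⟨p₀⟩ : Nonempty N₁ := inferInstance
  have hf (p : N₁) : f p = f p₀ := hM.warping_eq hβ p p₀
  have hCR : IsCRProduct S g₁ (g₂.scale (f p₀ ^ 2) (pow_pos (hM.f_pos p₀) 2).ne') ι :=
    { ι_smooth := hM.ι_smooth
      isometric := fun p q v₁ w₁ v₂ w₂ ↦ by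
        rw [hM.isometric, hf p]
        rfl
      totallyReal := hM.totallyReal
      invariant := hM.invariant }
  refine ⟨f p₀, hM.f_pos p₀, hf, hCR, fun hξ ↦ ⟨hCR, ?_⟩⟩
  rcases hξ with hξ | hξ
  · exact hξ
  -- This case is void: `ξ_β` is tangent to `N₂`, and if it were also tangent to `N₁` then `η^β`
  -- would vanish on it, against `η^β(ξ_β) = 1`.
  · obtain ⟨q⟩ := ‹Nonempty N₂›
    obtain ⟨u, hu⟩ := hβ p₀ q
    have h1 := hM.η_right_eq_zero (hξ β) p₀ q u
    rw [hu, S.η_ξ, if_pos rfl] at h1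
    exact absurd h1 one_ne_zero
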